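/- **Theorem (Probabilistic feasibility for variational inequalities).** Let $(\Delta,\mathcal F,\mathbb P)$ be a probability space, $F:\mathbb R^n\to\mathbb R^n$, and $\{\mathcal X_\delta\}_{\delta\in\Delta}$ a family of subsets of $\mathbb R^n$. For samples $\delta_1,\dots,\delta_m$ consider the variational inequality: find $x^\star\in\mathcal X:=\bigcap_{i=1}^m\mathcal X_{\delta_i}$ such that $F(x^\star)^\top(x-x^\star)\ge 0$ for all $x\in\mathcal X$. Assume that for every $m\ge 1$ and every tuple $(\delta_1,\dots,\delta_m)\in\Delta^m$ it has a unique solution $x^\star=x^\star(\delta_1,\dots,\delta_m)$, and that $(\delta_1,\dots,\delta_m)\mapsto x^\star$ and the set $\{(\delta,x): x\in\mathcal X_\delta\}$ are measurable. The risk of $x\in\mathbb R^n$ is $V(x)=\mathbb P\{\delta\in\Delta: x\notin\mathcal X_\delta\}$. The $i$-th sampled constraint is *of support* if its removal modifies the solution (that is, the solution set of the variational inequality without the constraint $\mathcal X_{\delta_i}$ is not $\{x^\star\}$; an empty family of constraints has feasible set $\mathbb R^n$), and $s^\star$ is the number of support constraints. Fix $N\ge1$ and $\beta\in(0,1)$,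 let $\delta_1,\dots,\delta_N$ be independent samples from $\mathbb P$, let $x^\star$ and $s^\star$ refer to these $N$ samples, and assume non-degeneracy: $\mathbb P^N$-almost surely, the variational inequality obtained by eliminating all the constraints that are not of support has $x^\star$ as its unique solution. For each $k\in\{0,\dots,N-1\}$ the equation $$\frac{\beta}{N+1}\sum_{l=k}^{N}\binom{l}{k}t^{l-k}-\binom{N}{k}t^{N-k}=0$$ has a unique solution $t(k)$ in $(0,1)$; put $t(k)=0$ for $k\ge N$, and $\varepsilon(k)=1-t(k)$. Then: (i) $\mathbb P^N[V(x^\star)\le\varepsilon(s^\star)]\ge 1-\beta$. (ii) If the sampled constraint sets $\mathcal X_{\delta_1},\dots,\mathcal X_{\delta_N}$ are convex, then $s^\star\le n$. If they are convex $\mathbb P^N$-almost surely, then also $\mathbb P^N[V(x^\star)\le\varepsilon(n)]\ge1-\beta$. -/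

import Mathlib

open MeasureTheory

namespace ScenarioVI

/-- The solution set of the variational inequality with operator `F` over the feasible set `K`:
points `x ∈ K` with `F(x)ᵀ (y - x) ≥ 0` for all `y ∈ K`. -/
def solutionSet {n : ℕ} (F : EuclideanSpace ℝ (Fin n) → EuclideanSpace ℝ (Fin n))
    (K : Set (EuclideanSpace ℝ (Fin n))) : Set (EuclideanSpace ℝ (Fin n)) :=
  {x | x ∈ K ∧ ∀ y ∈ K, 0 ≤ inner ℝ (F x) (y - x)}

/-- The intersection of the sampled constraint sets whose index lies in `I`
(the whole space if `I` is empty). -/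
def feasibleSet {n m : ℕ} {Δ : Type*} (X : Δ → Set (EuclideanSpace ℝ (Fin n)))
    (δ : Fin m → Δ) (I : Set (Fin m)) : Set (EuclideanSpace ℝ (Fin n)) :=
  ⋂ i ∈ I, X (δ i)

/-- Existence and uniqueness: for every sample size `m ≥ 1` and every tuple of samples, the
sampled variational inequality has exactly one solution, and it is `xstar m δ`. -/
def IsUniqueSolution {n : ℕ} {Δ : Type*}
    (F : EuclideanSpace ℝ (Fin n) → EuclideanSpace ℝ (Fin n))
    (X : Δ → Set (EuclideanSpace ℝ (Fin n)))
    (xstar : (m : ℕ) → (Fin m → Δ) → EuclideanSpace ℝ (Fin n)) : Prop :=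
  ∀ m : ℕ, 1 ≤ m → ∀ δ : Fin m → Δ,
    solutionSet F (feasibleSet X δ Set.univ) = {xstar m δ}

/-- The (indices of the) support constraints: those whose removal modifies the solution.
Solution sets are compared, so this also has a meaning when the only constraint is removed and
the unconstrained problem has no solution or several. -/
def supportConstraints {n m : ℕ} {Δ : Type*}
    (F : EuclideanSpace ℝ (Fin n) → EuclideanSpace ℝ (Fin n))
    (X : Δ → Set (EuclideanSpace ℝ (Fin n))) (δ : Fin m → Δ) : Set (Fin m) :=
  {i | solutionSet F (feasibleSet X δ {i}ᶜ) ≠ solutionSet F (feasibleSet X δ Set.univ)}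

/-- The number of support constraints. -/
noncomputable def numSupport {n m : ℕ} {Δ : Type*}
    (F : EuclideanSpace ℝ (Fin n) → EuclideanSpace ℝ (Fin n))
    (X : Δ → Set (EuclideanSpace ℝ (Fin n))) (δ : Fin m → Δ) : ℕ :=
  (supportConstraints F X δ).ncard

/-- Non-degeneracy for `N` independent samples: almost surely, eliminating all the constraints
that are not of support leaves the solution unchanged. -/
def NonDegenerate {n : ℕ} {Δ : Type*} [MeasurableSpace Δ] (P : Measure Δ)
    (F : EuclideanSpace ℝ (Fin n) → EuclideanSpace ℝ (Fin n))
    (X : Δ → Set (EuclideanSpace ℝ (Fin n))) (N : ℕ) : Prop :=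
  ∀ᵐ δ ∂(Measure.pi fun _ : Fin N => P),
    solutionSet F (feasibleSet X δ (supportConstraints F X δ)) =
      solutionSet F (feasibleSet X δ Set.univ)

/-- The risk `V(x) = P {δ | x ∉ X_δ}`. -/
noncomputable def risk {n : ℕ} {Δ : Type*} [MeasurableSpace Δ] (P : Measure Δ)
    (X : Δ → Set (EuclideanSpace ℝ (Fin n))) (x : EuclideanSpace ℝ (Fin n)) : ℝ :=
  P.real {d | x ∉ X d}

/-- The map `t`: for `k < N`, `t k` is a root in `(0,1)` of the polynomial equation
`β / (N + 1) * ∑_{l = k}^{N} (l choose k) t^(l - k) - (N choose k) t^(N - k) = 0`,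
and `t k = 0` for `k ≥ N`. -/
def IsThreshold (β : ℝ) (N : ℕ) (t : ℕ → ℝ) : Prop :=
  (∀ k < N, t k ∈ Set.Ioo (0 : ℝ) 1 ∧
    β / ((N : ℝ) + 1) * ∑ l ∈ Finset.Icc k N, (l.choose k : ℝ) * t k ^ (l - k)
      - (N.choose k : ℝ) * t k ^ (N - k) = 0) ∧
  ∀ k, N ≤ k → t k = 0

end ScenarioVI

/-! For an index set `I`, let `x_I` be the solution with only the constraints in `I`, and let `q = 1
- V(x_I)` be its acceptance probability. Since `x_I` depends on the samples in `I` alone, it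
satisfies the constraints of `J \ I` with conditional probability `q ^ #(J \ I)`. By non-degeneracy,
failure of (i) means almost surely that some irreducible `I` has `q < t(#I)` while `x_I` satisfies
all `N` constraints. For each `I` this has probability the integral of `q ^ (N - #I)` over `q <
t(#I)`.

The threshold equation is a dual certificate for bounding the sum of these integrals. Give each `J`
the weight `β / ((N + 1) * N.choose #J)`; the weights add up to `β`. For `0 < q < t(#I)`, the sign
of the threshold function says exactly that `q ^ (N - #I)` is below the weighted sum of `q ^ #(J \
I)` over `J ⊇ I` (`IsThreshold.pow_le_sum_supersets`). After integration and exchange of the sums,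
it remains to see that for fixed `J` the events "`I ⊆ J` is irreducible and `x_I` satisfies `J`"
have total probability at most one.

This holds because they are almost surely disjoint (`aedisjoint_decisiveEvent`), although
non-degeneracy is assumed for `N` samples only: if two such events overlapped with positive
probability, the independent samples outside `J` would also accept the common solution with positive
probability, and then both index sets would equal the support set.

For (ii), Helly's theorem is applied to the constraint sets and the open half-space of points that
are strictly better for the operator frozen at the solution (`numSupport_le`). Since `t` is
antitone, (i) then gives the bound with `ε(n)`. -/

namespace ScenarioVI

/-! ### The threshold equation: roots and monotonicity in `k`. -/

/-- The left-hand side of the equation defining the threshold `t k`. -/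
noncomputable def thresholdFun (β : ℝ) (N k : ℕ) (x : ℝ) : ℝ :=
  β / ((N : ℝ) + 1) * ∑ l ∈ Finset.Icc k N, (l.choose k : ℝ) * x ^ (l - k)
    - (N.choose k : ℝ) * x ^ (N - k)

theorem continuous_thresholdFun (β : ℝ) (N k : ℕ) : Continuous (thresholdFun β N k) := by
  unfold thresholdFun
  fun_prop

theorem thresholdFun_zero_pos {β : ℝ} (hβ : 0 < β) {N k : ℕ} (hk : k < N) :
    0 < thresholdFun β N k 0 := by
  have h : ∑ l ∈ Finset.Icc k N, (l.choose k : ℝ) * (0 : ℝ) ^ (l - k) = 1 := by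
    rw [Finset.sum_eq_single k]
    · simp
    · intro l hl hlk
      have : l - k ≠ 0 := by
        have := (Finset.mem_Icc.1 hl).1
        omega
      simp [this]
    · intro h
      exact absurd (Finset.mem_Icc.2 ⟨le_rfl, hk.le⟩) h
  have h' : N - k ≠ 0 := by omega
  rw [thresholdFun, h, zero_pow h']
  simp only [mul_one, mul_zero, sub_zero]
  positivity

/-- By the hockey-stick identity the sum at `1` is `(N + 1).choose (k + 1)`, which is at most `(N +
1) * N.choose k`. The factor `β / (N + 1)` with `β < 1` then makes the first term smaller than the
second. -/
theorem thresholdFun_one_neg {β : ℝ} (hβ : β < 1) {N k : ℕ} (hk : k ≤ N) :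
    thresholdFun β N k 1 < 0 := by
  have hN : (0 : ℝ) < (N : ℝ) + 1 := by positivity
  have hc : (0 : ℝ) < N.choose k := by exact_mod_cast Nat.choose_pos hk
  have hsum : ∑ l ∈ Finset.Icc k N, (l.choose k : ℝ) ≤ ((N : ℝ) + 1) * N.choose k := by
    have h1 : ∑ l ∈ Finset.Icc k N, (l.choose k : ℝ) = ((N + 1).choose (k + 1) : ℕ) := by
      rw [← Nat.sum_Icc_choose]; push_cast; rfl
    have h2 : ((N + 1) * N.choose k : ℕ) = (N + 1).choose (k + 1) * (k + 1) := by
      simpa using Nat.add_one_mul_choose_eq N k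
    rw [h1]
    have h3 : (N + 1).choose (k + 1) ≤ (N + 1) * N.choose k := by
      rw [h2]; exact Nat.le_mul_of_pos_right _ (Nat.succ_pos k)
    exact_mod_cast h3
  have hpos : 0 < ∑ l ∈ Finset.Icc k N, (l.choose k : ℝ) := by
    refine Finset.sum_pos (fun l hl => ?_) ⟨k, Finset.mem_Icc.2 ⟨le_rfl, hk⟩⟩
    exact_mod_cast Nat.choose_pos (Finset.mem_Icc.1 hl).1
  simp only [thresholdFun, one_pow, mul_one]
  rw [sub_neg, div_mul_eq_mul_div, div_lt_iff₀ hN]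
  nlinarith

/-- Divided by `x ^ (N - k)`, the threshold function is strictly decreasing. -/
theorem thresholdFun_mul_pow_lt {β : ℝ} (hβ : 0 < β) {N k : ℕ} (hk : k < N) {x y : ℝ}
    (hx : 0 < x) (hxy : x < y) :
    thresholdFun β N k y * x ^ (N - k) < thresholdFun β N k x * y ^ (N - k) := by
  have hy : 0 < y := hx.trans hxy
  have key : (∑ l ∈ Finset.Icc k N, (l.choose k : ℝ) * y ^ (l - k)) * x ^ (N - k)
      < (∑ l ∈ Finset.Icc k N, (l.choose k : ℝ) * x ^ (l - k)) * y ^ (N - k) := by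
    rw [Finset.sum_mul, Finset.sum_mul]
    have split : ∀ l ∈ Finset.Icc k N, ∀ z : ℝ,
        z ^ (N - k) = z ^ (l - k) * z ^ (N - l) := by
      intro l hl z
      obtain ⟨h1, h2⟩ := Finset.mem_Icc.1 hl
      rw [← pow_add]
      congr 1
      omega
    refine Finset.sum_lt_sum (fun l hl => ?_) ⟨k, Finset.mem_Icc.2 ⟨le_rfl, hk.le⟩, ?_⟩
    · rw [split l hl x, split l hl y]
      have : x ^ (N - l) ≤ y ^ (N - l) := by gcongr
      calc (l.choose k : ℝ) * y ^ (l - k) * (x ^ (l - k) * x ^ (N - l))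
          = (l.choose k : ℝ) * y ^ (l - k) * x ^ (l - k) * x ^ (N - l) := by ring
        _ ≤ (l.choose k : ℝ) * y ^ (l - k) * x ^ (l - k) * y ^ (N - l) := by gcongr
        _ = _ := by ring
    · have : N - k ≠ 0 := by omega
      simpa using pow_lt_pow_left₀ hxy hx.le this
  have hc : 0 < β / ((N : ℝ) + 1) := by positivity
  have := mul_lt_mul_of_pos_left key hc
  unfold thresholdFun
  linarith

theorem thresholdFun_pos_of_lt {β : ℝ} (hβ : 0 < β) {N k : ℕ} (hk : k < N) {x y : ℝ}
    (hx : 0 < x) (hxy : x < y) (hy : thresholdFun β N k y = 0) : 0 < thresholdFun β N k x := by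
  have h := thresholdFun_mul_pow_lt hβ hk hx hxy
  rw [hy, zero_mul] at h
  exact pos_of_mul_pos_left h (pow_pos (hx.trans hxy) _).le

theorem thresholdFun_neg_of_lt {β : ℝ} (hβ : 0 < β) {N k : ℕ} (hk : k < N) {x y : ℝ}
    (hx : 0 < x) (hxy : x < y) (hx0 : thresholdFun β N k x = 0) : thresholdFun β N k y < 0 := by
  have h := thresholdFun_mul_pow_lt hβ hk hx hxy
  rw [hx0, zero_mul] at h
  exact neg_of_mul_neg_left h (pow_pos hx _).le

theorem thresholdFun_root_unique {β : ℝ} (hβ : 0 < β) {N k : ℕ} (hk : k < N) {x y : ℝ}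
    (hx : 0 < x) (hy : 0 < y) (hx0 : thresholdFun β N k x = 0) (hy0 : thresholdFun β N k y = 0) :
    x = y := by
  rcases lt_trichotomy x y with h | h | h
  · exact absurd hy0 (thresholdFun_neg_of_lt hβ hk hx h hx0).ne
  · exact h
  · exact absurd hx0 (thresholdFun_neg_of_lt hβ hk hy h hy0).ne

theorem exists_thresholdFun_root {β : ℝ} (hβ : β ∈ Set.Ioo (0 : ℝ) 1) {N k : ℕ} (hk : k < N) :
    ∃ x ∈ Set.Ioo (0 : ℝ) 1, thresholdFun β N k x = 0 :=
  intermediate_value_Ioo' zero_le_one (continuous_thresholdFun β N k).continuousOn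
    ⟨thresholdFun_one_neg hβ.2 hk.le, thresholdFun_zero_pos hβ.1 hk⟩

theorem existsUnique_isThreshold {β : ℝ} (hβ : β ∈ Set.Ioo (0 : ℝ) 1) (N : ℕ) :
    ∃! t : ℕ → ℝ, IsThreshold β N t := by
  choose! r hr using fun k (hk : k < N) => exists_thresholdFun_root hβ hk
  refine ⟨fun k => if k < N then r k else 0, ⟨fun k hk => ?_, fun k hk => ?_⟩, ?_⟩
  · simp only [hk, if_true]
    exact hr k hk
  · simp [hk.not_gt]
  · rintro t ⟨h1, h2⟩
    funext k
    by_cases hk : k < N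
    · simp only [hk, if_true]
      exact thresholdFun_root_unique hβ.1 hk (h1 k hk).1.1 (hr k hk).1.1 (h1 k hk).2 (hr k hk).2
    · simpa [hk] using h2 k (not_lt.1 hk)

/-- The ratio `l.choose (k + 1) / l.choose k = (l - k) / (k + 1)` increases with `l`. -/
theorem choose_succ_mul_choose_le {l N : ℕ} (h : l ≤ N) (k : ℕ) :
    l.choose (k + 1) * N.choose k ≤ l.choose k * N.choose (k + 1) := by
  refine Nat.le_of_mul_le_mul_right ?_ (Nat.succ_pos k)
  calc l.choose (k + 1) * N.choose k * (k + 1)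
      = l.choose (k + 1) * (k + 1) * N.choose k := by ring
    _ = l.choose k * (l - k) * N.choose k := by rw [Nat.choose_succ_right_eq]
    _ ≤ l.choose k * (N - k) * N.choose k := by gcongr
    _ = l.choose k * (N.choose k * (N - k)) := by ring
    _ = l.choose k * N.choose (k + 1) * (k + 1) := by rw [← Nat.choose_succ_right_eq]; ring

/-- After scaling by `x * N.choose k` and `N.choose (k + 1)` respectively, the functions for `k + 1`
and `k` have the same subtracted term, and their sums compare term by term. This places the root for
`k` at or to the right of the root for `k + 1`. -/
theorem thresholdFun_nonneg_of_succ_root {β : ℝ} (hβ : 0 < β) {N k : ℕ} (hk : k + 1 < N) {x : ℝ}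
    (hx : 0 < x) (hx0 : thresholdFun β N (k + 1) x = 0) : 0 ≤ thresholdFun β N k x := by
  have hc : (0 : ℝ) < N.choose (k + 1) := by exact_mod_cast Nat.choose_pos hk.le
  have hsum : (∑ l ∈ Finset.Icc (k + 1) N, (l.choose (k + 1) : ℝ) * x ^ (l - (k + 1))) * x
      * N.choose k
      ≤ (∑ l ∈ Finset.Icc k N, (l.choose k : ℝ) * x ^ (l - k)) * N.choose (k + 1) := by
    rw [Finset.sum_mul, Finset.sum_mul, Finset.sum_mul]
    calc _ ≤ ∑ l ∈ Finset.Icc (k + 1) N,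
          (l.choose k : ℝ) * x ^ (l - k) * N.choose (k + 1) := by
          refine Finset.sum_le_sum fun l hl => ?_
          obtain ⟨h1, h2⟩ := Finset.mem_Icc.1 hl
          have hp : x ^ (l - k) = x ^ (l - (k + 1)) * x := by
            rw [← pow_succ]; congr 1; omega
          have hch : (l.choose (k + 1) : ℝ) * N.choose k ≤ l.choose k * N.choose (k + 1) := by
            exact_mod_cast choose_succ_mul_choose_le h2 k
          calc (l.choose (k + 1) : ℝ) * x ^ (l - (k + 1)) * x * N.choose k
              = (l.choose (k + 1) : ℝ) * N.choose k * x ^ (l - k) := by rw [hp]; ring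
            _ ≤ (l.choose k * N.choose (k + 1)) * x ^ (l - k) := by gcongr
            _ = _ := by ring
      _ ≤ _ := by
          refine Finset.sum_le_sum_of_subset_of_nonneg
            (Finset.Icc_subset_Icc_left (Nat.le_succ k)) fun l _ _ => by positivity
  have hpN : x ^ (N - k) = x ^ (N - (k + 1)) * x := by
    rw [← pow_succ]; congr 1; omega
  have hβN : 0 < β / ((N : ℝ) + 1) := by positivity
  have h1 := mul_le_mul_of_nonneg_left hsum hβN.le
  refine nonneg_of_mul_nonneg_left ?_ hc
  have h2 : thresholdFun β N (k + 1) x * x * N.choose k = 0 := by rw [hx0]; ring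
  unfold thresholdFun at h2 ⊢
  rw [hpN]
  linarith

theorem IsThreshold.nonneg {β : ℝ} {N : ℕ} {t : ℕ → ℝ} (ht : IsThreshold β N t) (k : ℕ) :
    0 ≤ t k := by
  by_cases hk : k < N
  · exact (ht.1 k hk).1.1.le
  · exact (ht.2 k (not_lt.1 hk)).ge

theorem IsThreshold.antitone {β : ℝ} (hβ : 0 < β) {N : ℕ} {t : ℕ → ℝ}
    (ht : IsThreshold β N t) : Antitone t := by
  refine antitone_nat_of_succ_le fun k => ?_
  by_cases hk : k + 1 < N
  · by_contra! hlt
    have hk' : k < N := by omega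
    have h1 := thresholdFun_nonneg_of_succ_root hβ hk (ht.1 _ hk).1.1 (ht.1 _ hk).2
    exact (thresholdFun_neg_of_lt hβ hk' (ht.1 _ hk').1.1 hlt (ht.1 _ hk').2).not_ge h1
  · rw [ht.2 _ (not_lt.1 hk)]
    exact ht.nonneg k

/-! ### Weights on index sets. -/

/-- Weighting each `J ⊇ I` by the inverse number of subsets of its size, the binomial sum of the
threshold equation becomes a sum over the supersets of `I`. -/
theorem sum_supersets_eq {N : ℕ} (I : Finset (Fin N)) (c q : ℝ) :
    ∑ J with I ⊆ J, c / (N.choose J.card : ℝ) * q ^ (J \ I).card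
      = c * (∑ l ∈ Finset.Icc I.card N, (l.choose I.card : ℝ) * q ^ (l - I.card))
          / N.choose I.card := by
  have hIN : I.card ≤ N := by simpa using Finset.card_le_univ I
  have h1 : ∑ J with I ⊆ J, c / (N.choose J.card : ℝ) * q ^ (J \ I).card
      = ∑ T ∈ Iᶜ.powerset, c / (N.choose (I.card + T.card) : ℝ) * q ^ T.card := by
    refine Finset.sum_nbij' (fun J => J \ I) (fun T => I ∪ T) ?_ ?_ ?_ ?_ ?_
    · intro J _
      rw [Finset.mem_powerset]
      intro x hx
      simpa using (Finset.mem_sdiff.1 hx).2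
    · intro T _
      simp
    · intro J hJ
      exact Finset.union_sdiff_of_subset (by simpa using hJ)
    · intro T hT
      rw [Finset.mem_powerset] at hT
      ext x
      have := @hT x
      simp only [Finset.mem_compl] at this
      simp only [Finset.mem_sdiff, Finset.mem_union]
      tauto
    · intro J hJ
      have hIJ : I ⊆ J := by simpa using hJ
      rw [← Finset.card_sdiff_add_card_eq_card hIJ, add_comm]
  rw [h1, Finset.sum_powerset_apply_card
    (fun m => c / (N.choose (I.card + m) : ℝ) * q ^ m), Finset.card_compl, Fintype.card_fin,
    mul_div_assoc, Finset.sum_div, Finset.mul_sum]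
  refine Finset.sum_nbij' (fun m => I.card + m) (fun l => l - I.card) ?_ ?_ ?_ ?_ ?_
  · intro m hm
    simp only [Finset.mem_range, Finset.mem_Icc] at hm ⊢
    omega
  · intro l hl
    simp only [Finset.mem_range, Finset.mem_Icc] at hl ⊢
    omega
  · intro m _
    simp
  · intro l hl
    simp only [Finset.mem_Icc] at hl
    omega
  · intro m hm
    have hm' : I.card + m ≤ N := by
      simp only [Finset.mem_range] at hm
      omega
    -- Double counting of pairs `I ⊆ J` turns the number of supersets of a given size into the
    -- coefficient of the threshold equation.
    have h2 : ((N.choose (I.card + m) : ℝ)) * (I.card + m).choose I.card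
        = N.choose I.card * (N - I.card).choose m := by
      have := Nat.choose_mul (n := N) (k := I.card + m) (s := I.card) (by omega)
      rw [Nat.add_sub_cancel_left] at this
      exact_mod_cast this
    have h3 : (N.choose (I.card + m) : ℝ) ≠ 0 := by
      exact_mod_cast (Nat.choose_pos hm').ne'
    have h4 : (N.choose I.card : ℝ) ≠ 0 := by
      exact_mod_cast (Nat.choose_pos hIN).ne'
    rw [nsmul_eq_mul, Nat.add_sub_cancel_left]
    field_simp
    linear_combination (-(c * q ^ m)) * h2

/-- Below the threshold, the last term of the superset sum is dominated by the whole sum. -/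
theorem IsThreshold.pow_le_sum_supersets {β : ℝ} (hβ : 0 < β) {N : ℕ} {t : ℕ → ℝ}
    (ht : IsThreshold β N t) (I : Finset (Fin N)) (hI : I.card < N) {q : ℝ} (hq : 0 < q)
    (hqt : q < t I.card) :
    q ^ (N - I.card) ≤
      ∑ J with I ⊆ J, β / ((N : ℝ) + 1) / (N.choose J.card : ℝ) * q ^ (J \ I).card := by
  have h := thresholdFun_pos_of_lt hβ hI hq hqt (ht.1 _ hI).2
  have hc : (0 : ℝ) < N.choose I.card := by exact_mod_cast Nat.choose_pos hI.le
  rw [sum_supersets_eq, le_div_iff₀ hc]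
  unfold thresholdFun at h
  linarith

/-- Each of the `N + 1` possible sizes carries total weight `β / (N + 1)`. -/
theorem sum_subset_weights {N : ℕ} (β : ℝ) :
    ∑ J : Finset (Fin N), β / ((N : ℝ) + 1) / (N.choose J.card : ℝ) = β := by
  have hN : (N : ℝ) + 1 ≠ 0 := by positivity
  rw [← Finset.powerset_univ, Finset.sum_powerset_apply_card
    (fun m => β / ((N : ℝ) + 1) / (N.choose m : ℝ)), Finset.card_univ, Fintype.card_fin]
  rw [Finset.sum_congr rfl (g := fun _ => β / ((N : ℝ) + 1))]
  · rw [Finset.sum_const, Finset.card_range, nsmul_eq_mul]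
    push_cast
    field_simp
  · intro m hm
    have : (N.choose m : ℝ) ≠ 0 := by
      exact_mod_cast (Nat.choose_pos (Nat.lt_succ_iff.1 (Finset.mem_range.1 hm))).ne'
    rw [nsmul_eq_mul]
    field_simp

/-! ### Deterministic structure: subproblems, irreducible sets and support constraints. -/

section Structure

variable {n m : ℕ} {Δ : Type*} {F : EuclideanSpace ℝ (Fin n) → EuclideanSpace ℝ (Fin n)}
  {X : Δ → Set (EuclideanSpace ℝ (Fin n))} {δ δ' : Fin m → Δ} {I J : Set (Fin m)}
  {x : EuclideanSpace ℝ (Fin n)}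

theorem mem_solutionSet_of_subset {K K' : Set (EuclideanSpace ℝ (Fin n))} (hK : K' ⊆ K)
    (hx : x ∈ solutionSet F K) (hx' : x ∈ K') : x ∈ solutionSet F K' :=
  ⟨hx', fun y hy => hx.2 y (hK hy)⟩

theorem mem_feasibleSet : x ∈ feasibleSet X δ I ↔ ∀ i ∈ I, x ∈ X (δ i) := by
  simp [feasibleSet]

theorem feasibleSet_empty : feasibleSet X δ ∅ = Set.univ := by
  simp [feasibleSet]

theorem feasibleSet_anti (h : I ⊆ J) : feasibleSet X δ J ⊆ feasibleSet X δ I :=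
  Set.biInter_mono h fun _ _ => subset_rfl

theorem feasibleSet_congr (h : ∀ i ∈ I, δ i = δ' i) : feasibleSet X δ I = feasibleSet X δ' I :=
  Set.iInter₂_congr fun i hi => by rw [h i hi]

theorem feasibleSet_coe_finset (I : Finset (Fin m)) :
    feasibleSet X δ (I : Set (Fin m))
      = feasibleSet X (fun j => δ (I.orderEmbOfFin rfl j)) Set.univ := by
  ext x
  simp only [mem_feasibleSet, Set.mem_univ, forall_const, Finset.mem_coe]
  constructor
  · exact fun h j => h _ (Finset.orderEmbOfFin_mem I rfl j)
  · intro h i hi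
    obtain ⟨j, rfl⟩ : i ∈ Set.range (I.orderEmbOfFin rfl) := by
      rwa [Finset.range_orderEmbOfFin]
    exact h j

theorem IsUniqueSolution.solutionSet_coe_finset
    {xstar : (m : ℕ) → (Fin m → Δ) → EuclideanSpace ℝ (Fin n)} (h : IsUniqueSolution F X xstar)
    {I : Finset (Fin m)} (hI : I.Nonempty) :
    solutionSet F (feasibleSet X δ I) = {xstar I.card fun j => δ (I.orderEmbOfFin rfl j)} := by
  rw [feasibleSet_coe_finset]
  exact h _ hI.card_pos _

theorem IsUniqueSolution.exists_eq_singleton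
    {xstar : (m : ℕ) → (Fin m → Δ) → EuclideanSpace ℝ (Fin n)} (h : IsUniqueSolution F X xstar)
    (δ : Fin m → Δ) (hI : I.Nonempty) : ∃ x, solutionSet F (feasibleSet X δ I) = {x} := by
  classical
  have hI' : (I.toFinite.toFinset).Nonempty := by simpa using hI
  have := h.solutionSet_coe_finset (δ := δ) hI'
  rw [Set.Finite.coe_toFinset] at this
  exact ⟨_, this⟩

/-- A solution with the constraints in `I` that satisfies the further constraints in `J` is the
solution with the constraints in `J`. -/
theorem IsUniqueSolution.solutionSet_eq_of_subset
    {xstar : (m : ℕ) → (Fin m → Δ) → EuclideanSpace ℝ (Fin n)} (h : IsUniqueSolution F X xstar)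
    (hIJ : I ⊆ J) (hx : solutionSet F (feasibleSet X δ I) = {x}) (hxJ : x ∈ feasibleSet X δ J) :
    solutionSet F (feasibleSet X δ J) = {x} := by
  -- Uniqueness is assumed for at least one constraint only, so empty `J` is separate; it forces `I
  -- = J`.
  rcases J.eq_empty_or_nonempty with rfl | hJ
  · rwa [Set.subset_empty_iff.1 hIJ] at hx
  · obtain ⟨y, hy⟩ := h.exists_eq_singleton δ hJ
    have hxs : x ∈ solutionSet F (feasibleSet X δ J) :=
      mem_solutionSet_of_subset (feasibleSet_anti hIJ) (by rw [hx]; rfl) hxJ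
    rw [hy] at hxs ⊢
    rw [Set.mem_singleton_iff.1 hxs]

open Classical in
/-- A solution of the variational inequality over `K`, or `0` if there is none. -/
noncomputable def chosenSolution (F : EuclideanSpace ℝ (Fin n) → EuclideanSpace ℝ (Fin n))
    (K : Set (EuclideanSpace ℝ (Fin n))) : EuclideanSpace ℝ (Fin n) :=
  if h : (solutionSet F K).Nonempty then h.some else 0

theorem chosenSolution_eq {K : Set (EuclideanSpace ℝ (Fin n))} (h : solutionSet F K = {x}) :
    chosenSolution F K = x := by
  have hne : (solutionSet F K).Nonempty := by rw [h]; exact Set.singleton_nonempty x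
  rw [chosenSolution, dif_pos hne]
  exact Set.mem_singleton_iff.1 (h.subset hne.some_mem)

/-- The constraints in `I` determine a unique solution, and none of them can be removed without
modifying it. -/
def IsIrreducible (F : EuclideanSpace ℝ (Fin n) → EuclideanSpace ℝ (Fin n))
    (X : Δ → Set (EuclideanSpace ℝ (Fin n))) (I : Set (Fin m)) (δ : Fin m → Δ) : Prop :=
  (∃ x, solutionSet F (feasibleSet X δ I) = {x}) ∧
    ∀ i ∈ I, solutionSet F (feasibleSet X δ (I \ {i})) ≠ solutionSet F (feasibleSet X δ I)

theorem isIrreducible_congr (h : ∀ i ∈ I, δ i = δ' i) :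
    IsIrreducible F X I δ ↔ IsIrreducible F X I δ' := by
  unfold IsIrreducible
  rw [feasibleSet_congr (X := X) h]
  refine and_congr_right fun _ => forall₂_congr fun i hi => ?_
  rw [feasibleSet_congr (X := X) fun j hj => h j (Set.sdiff_subset hj)]

/-- If a support constraint `i` could be dropped from the support set, the remaining ones would
still determine `x`. As `x` is feasible for everything, it would then solve the problem with only
`i` removed, contradicting that `i` is of support. -/
theorem IsUniqueSolution.isIrreducible_supportConstraints
    {xstar : (m : ℕ) → (Fin m → Δ) → EuclideanSpace ℝ (Fin n)} (h : IsUniqueSolution F X xstar)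
    (hx : solutionSet F (feasibleSet X δ Set.univ) = {x})
    (hs : solutionSet F (feasibleSet X δ (supportConstraints F X δ)) =
      solutionSet F (feasibleSet X δ Set.univ)) :
    IsIrreducible F X (supportConstraints F X δ) δ := by
  refine ⟨⟨x, hs.trans hx⟩, fun i hi hne => hi ?_⟩
  rw [hx]
  have hxu : x ∈ feasibleSet X δ Set.univ :=
    (show x ∈ solutionSet F (feasibleSet X δ Set.univ) by rw [hx]; rfl).1
  exact h.solutionSet_eq_of_subset (fun j hj => hj.2) (hne.trans (hs.trans hx))
    (feasibleSet_anti (Set.subset_univ _) hxu)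

/-- In the non-degenerate case, the support constraints are the only irreducible set of
constraints that determines the solution. -/
theorem IsUniqueSolution.eq_supportConstraints
    {xstar : (m : ℕ) → (Fin m → Δ) → EuclideanSpace ℝ (Fin n)} (h : IsUniqueSolution F X xstar)
    (hs : solutionSet F (feasibleSet X δ (supportConstraints F X δ)) =
      solutionSet F (feasibleSet X δ Set.univ))
    (hI : IsIrreducible F X I δ) (hxI : solutionSet F (feasibleSet X δ I) = {x})
    (hxu : x ∈ feasibleSet X δ Set.univ) : I = supportConstraints F X δ := by
  have hx : solutionSet F (feasibleSet X δ Set.univ) = {x} :=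
    h.solutionSet_eq_of_subset (Set.subset_univ _) hxI hxu
  -- A constraint outside `I` can be removed: `I` still determines `x`, which satisfies all the
  -- others.
  have hsub : supportConstraints F X δ ⊆ I := by
    intro i hi
    by_contra hiI
    refine hi ?_
    rw [hx]
    exact h.solutionSet_eq_of_subset (fun j hj hji => hiI (hji ▸ hj)) hxI
      (feasibleSet_anti (Set.subset_univ _) hxu)
  refine Set.Subset.antisymm (fun i hi => ?_) hsub
  by_contra his
  refine hI.2 i hi ?_
  rw [hxI]
  exact h.solutionSet_eq_of_subset
    (fun j hj => ⟨hsub hj, fun hji => his (Set.mem_singleton_iff.1 hji ▸ hj)⟩)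
    (hs.trans hx) (feasibleSet_anti (Set.subset_univ _) hxu)

/-! ### Bounding the number of support constraints by Helly's theorem. -/

/-- In dimension zero, a feasible point is the unique solution. -/
theorem solutionSet_eq_singleton_of_dim_zero (hn : n = 0) {K : Set (EuclideanSpace ℝ (Fin n))}
    (hx : x ∈ K) : solutionSet F K = {x} := by
  subst hn
  ext y
  rw [Subsingleton.elim y x]
  simp only [Set.mem_singleton_iff, iff_true]
  exact ⟨hx, fun z _ => by rw [Subsingleton.elim z x]; simp⟩

/-- Removing a support constraint makes a strictly better point (for the objective frozen at the
solution) feasible, if other constraints remain. -/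
theorem IsUniqueSolution.exists_inner_neg_of_mem_supportConstraints
    {xstar : (m : ℕ) → (Fin m → Δ) → EuclideanSpace ℝ (Fin n)} (h : IsUniqueSolution F X xstar)
    (hm : 2 ≤ m) (hx : solutionSet F (feasibleSet X δ Set.univ) = {x}) {i : Fin m}
    (hi : i ∈ supportConstraints F X δ) :
    ∃ y ∈ feasibleSet X δ {i}ᶜ, inner ℝ (F x) (y - x) < 0 := by
  by_contra! hcon
  have : Nontrivial (Fin m) := Fin.nontrivial_iff_two_le.2 hm
  obtain ⟨j, hj⟩ := exists_ne i
  obtain ⟨z, hz⟩ := h.exists_eq_singleton δ (I := {i}ᶜ) ⟨j, hj⟩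
  have hxu : x ∈ feasibleSet X δ Set.univ :=
    (show x ∈ solutionSet F (feasibleSet X δ Set.univ) by rw [hx]; rfl).1
  have hxs : x ∈ solutionSet F (feasibleSet X δ {i}ᶜ) :=
    ⟨feasibleSet_anti (Set.subset_univ _) hxu, hcon⟩
  refine hi ?_
  rw [hz] at hxs ⊢
  rw [hx, Set.mem_singleton_iff.1 hxs]

/-- With convex constraint sets, the number of support constraints is at most the dimension. -/
theorem IsUniqueSolution.numSupport_le
    {xstar : (m : ℕ) → (Fin m → Δ) → EuclideanSpace ℝ (Fin n)} (h : IsUniqueSolution F X xstar)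
    (hm : 1 ≤ m) (δ : Fin m → Δ) (hconv : ∀ i, Convex ℝ (X (δ i))) : numSupport F X δ ≤ n := by
  classical
  obtain ⟨x, hx⟩ : ∃ x, solutionSet F (feasibleSet X δ Set.univ) = {x} := ⟨_, h m hm δ⟩
  have hxs : x ∈ solutionSet F (feasibleSet X δ Set.univ) := by rw [hx]; rfl
  have hxu := hxs.1
  -- With a single constraint, its removal leaves the unconstrained problem, for which no solution
  -- is guaranteed; the bound is then checked directly.
  rcases hm.eq_or_lt with hm1 | hm2
  · rcases Nat.eq_zero_or_pos n with hn | hn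
    · have : supportConstraints F X δ = ∅ := by
        ext i
        simp only [Set.mem_empty_iff_false, iff_false]
        refine fun hi => hi ?_
        rw [hx]
        exact solutionSet_eq_singleton_of_dim_zero hn (feasibleSet_anti (Set.subset_univ _) hxu)
      simp [numSupport, this]
    · calc numSupport F X δ ≤ (Set.univ : Set (Fin m)).ncard :=
            Set.ncard_le_ncard (Set.subset_univ _)
        _ = m := by simp [Set.ncard_univ]
        _ ≤ n := by omega
  · by_contra! hlt
    -- `none` indexes the half-space of strictly better points. A point common to the whole family
    -- contradicts the optimality of `x`.
    let G : Option (Fin m) → Set (EuclideanSpace ℝ (Fin n)) := fun o =>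
      o.elim {y | inner ℝ (F x) (y - x) < 0} fun i => X (δ i)
    have hG : ∀ o ∈ (Finset.univ : Finset (Option (Fin m))), Convex ℝ (G o) := by
      rintro (_ | i) -
      · have : {y | inner ℝ (F x) (y - x) < 0} =
            {y | innerSL ℝ (F x) y < inner ℝ (F x) x} := by
          ext y
          simp [inner_sub_right]
        change Convex ℝ {y | inner ℝ (F x) (y - x) < 0}
        rw [this]
        exact convex_halfSpace_lt (innerSL ℝ (F x)).toLinearMap.isLinear _
      · exact hconv i
    have hinter : ∀ I ⊆ (Finset.univ : Finset (Option (Fin m))),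
        I.card ≤ Module.finrank ℝ (EuclideanSpace ℝ (Fin n)) + 1 → (⋂ o ∈ I, G o).Nonempty := by
      intro I _ hI
      rw [finrank_euclideanSpace_fin] at hI
      by_cases hnone : none ∈ I
      · obtain ⟨i, hi, hiI⟩ : ∃ i ∈ supportConstraints F X δ, some i ∉ I := by
          by_contra! hall
          have hsub : insert none ((supportConstraints F X δ).toFinite.toFinset.map
              Function.Embedding.some) ⊆ I := by
            intro o ho
            rcases Finset.mem_insert.1 ho with rfl | ho
            · exact hnone
            · obtain ⟨i, hi, rfl⟩ := Finset.mem_map.1 ho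
              exact hall i (by simpa using hi)
          have hc := Finset.card_le_card hsub
          rw [Finset.card_insert_of_notMem (by simp), Finset.card_map,
            ← Set.ncard_eq_toFinset_card] at hc
          unfold numSupport at hlt
          omega
        obtain ⟨y, hy, hyneg⟩ := h.exists_inner_neg_of_mem_supportConstraints hm2 hx hi
        refine ⟨y, Set.mem_iInter₂.2 ?_⟩
        rintro (_ | j) hj
        · exact hyneg
        · exact mem_feasibleSet.1 hy j fun hji => hiI (Set.mem_singleton_iff.1 hji ▸ hj)
      · refine ⟨x, Set.mem_iInter₂.2 ?_⟩
        rintro (_ | j) hj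
        · exact absurd hj hnone
        · exact mem_feasibleSet.1 hxu j trivial
    obtain ⟨y, hy⟩ := Convex.helly_theorem' hG hinter
    have hy' := fun o => Set.mem_iInter₂.1 hy o (Finset.mem_univ o)
    exact (hxs.2 y (mem_feasibleSet.2 fun i _ => hy' (some i))).not_gt (hy' none)

end Structure

/-! ### Conditioning on part of the samples. -/

section Probability

variable {n N : ℕ} {Δ : Type*} [MeasurableSpace Δ] {P : Measure Δ} [IsProbabilityMeasure P]
  {F : EuclideanSpace ℝ (Fin n) → EuclideanSpace ℝ (Fin n)}
  {X : Δ → Set (EuclideanSpace ℝ (Fin n))}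

theorem measurable_measure_constraint
    (hX : MeasurableSet {p : Δ × EuclideanSpace ℝ (Fin n) | p.2 ∈ X p.1}) :
    Measurable fun x : EuclideanSpace ℝ (Fin n) => P {d | x ∈ X d} :=
  measurable_measure_prodMk_right hX

theorem risk_eq (hX : MeasurableSet {p : Δ × EuclideanSpace ℝ (Fin n) | p.2 ∈ X p.1})
    (x : EuclideanSpace ℝ (Fin n)) : risk P X x = 1 - P.real {d | x ∈ X d} := by
  have : MeasurableSet {d | x ∈ X d} := measurable_prodMk_right hX
  exact probReal_compl_eq_one_sub this

/-- If an event `G` and a point `y` depend on the samples in `I` only, the samples in `J \ I` are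
independent of them: the constraints in `J \ I` are satisfied by `y` with conditional probability
`P {d | y ∈ X d} ^ #(J \ I)`. -/
theorem measure_pi_inter_constraints
    (hX : MeasurableSet {p : Δ × EuclideanSpace ℝ (Fin n) | p.2 ∈ X p.1})
    (I J : Finset (Fin N)) {G : Set (Fin N → Δ)} (hG : MeasurableSet G)
    {y : (Fin N → Δ) → EuclideanSpace ℝ (Fin n)} (hy : Measurable y)
    (hGdep : ∀ δ δ' : Fin N → Δ, (∀ i ∈ I, δ i = δ' i) → (δ ∈ G ↔ δ' ∈ G))
    (hydep : ∀ δ δ' : Fin N → Δ, (∀ i ∈ I, δ i = δ' i) → y δ = y δ') :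
    (Measure.pi fun _ : Fin N => P) (G ∩ {δ | ∀ j ∈ J \ I, y δ ∈ X (δ j)})
      = ∫⁻ δ in G, P {d | y δ ∈ X d} ^ (J \ I).card ∂(Measure.pi fun _ : Fin N => P) := by
  classical
  have hp : Measurable fun δ => P {d | y δ ∈ X d} := (measurable_measure_constraint hX).comp hy
  have hS : MeasurableSet (G ∩ {δ | ∀ j ∈ J \ I, y δ ∈ X (δ j)}) := by
    refine hG.inter ?_
    simp only [Set.ofPred_forall]
    refine MeasurableSet.iInter fun j => MeasurableSet.iInter fun _ => ?_
    exact ((measurable_pi_apply j).prodMk hy) hX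
  -- Fubini over the samples in `I` and those outside: both sides are compared for fixed samples `a`
  -- in `I`.
  have hmp := (measurePreserving_piEquivPiSubtypeProd (fun _ : Fin N => P) (· ∈ I)).symm
  rw [← lintegral_indicator_one hS, ← lintegral_indicator hG]
  rw [← hmp.lintegral_comp (measurable_one.indicator hS),
    ← hmp.lintegral_comp ((hp.pow_const _).indicator hG)]
  refine (lintegral_prod _ ((measurable_one.indicator hS).comp hmp.measurable).aemeasurable).trans
    (Eq.trans (lintegral_congr fun a => ?_) (lintegral_prod _
      (((hp.pow_const (J \ I).card).indicator hG).comp hmp.measurable).aemeasurable).symm)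
  set e := (MeasurableEquiv.piEquivPiSubtypeProd (fun _ : Fin N => Δ) (· ∈ I)).symm with he
  have he1 : ∀ b b', ∀ i ∈ I, e (a, b) i = e (a, b') i := by
    intro b b' i hi
    simp [he, MeasurableEquiv.piEquivPiSubtypeProd, Equiv.piEquivPiSubtypeProd, hi]
  have he2 : ∀ b (i : Fin N) (hi : i ∉ I), e (a, b) i = b ⟨i, hi⟩ := by
    intro b i hi
    simp [he, MeasurableEquiv.piEquivPiSubtypeProd, Equiv.piEquivPiSubtypeProd, hi]
  obtain ⟨d₀⟩ : Nonempty Δ := nonempty_of_isProbabilityMeasure P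
  -- The completion outside `I` is arbitrary, since `G` and `y` do not depend on it.
  set δ₀ := e (a, fun _ => d₀) with hδ₀
  have hGb : ∀ b, e (a, b) ∈ G ↔ δ₀ ∈ G := fun b => hGdep _ _ (he1 _ _)
  have hyb : ∀ b, y (e (a, b)) = y δ₀ := fun b => hydep _ _ (he1 _ _)
  by_cases h₀ : δ₀ ∈ G
  · have hR : ∀ b, G.indicator (fun δ => P {d | y δ ∈ X d} ^ (J \ I).card) (e (a, b))
        = P {d | y δ₀ ∈ X d} ^ (J \ I).card := by
      intro b
      rw [Set.indicator_of_mem ((hGb b).2 h₀), hyb]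
    simp only [Function.comp_def] at hR ⊢
    simp only [hR, lintegral_const, measure_univ, mul_one]
    have hset : (fun b => (G ∩ {δ | ∀ j ∈ J \ I, y δ ∈ X (δ j)}).indicator
        (1 : (Fin N → Δ) → ENNReal) (e (a, b)))
        = (Set.univ.pi fun j : {j // j ∉ I} =>
            if (j : Fin N) ∈ J then {d | y δ₀ ∈ X d} else Set.univ).indicator 1 := by
      funext b
      have hiff : e (a, b) ∈ (G ∩ {δ | ∀ j ∈ J \ I, y δ ∈ X (δ j)}) ↔
          b ∈ Set.univ.pi fun j : {j // j ∉ I} =>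
            if (j : Fin N) ∈ J then {d | y δ₀ ∈ X d} else Set.univ := by
        simp only [Set.mem_inter_iff, hGb, h₀, true_and, Set.mem_ofPred_eq, hyb, Set.mem_pi,
          Set.mem_univ, forall_const, Finset.mem_sdiff, Subtype.forall]
        refine forall_congr' fun j => ⟨fun h hj => ?_, fun h hj => ?_⟩
        · split_ifs with hJ
          · simpa [he2 b j hj] using h ⟨hJ, hj⟩
          · trivial
        · have := h hj.2
          rw [if_pos hj.1] at this
          simpa [he2 b j hj.2] using this
      by_cases hb : e (a, b) ∈ (G ∩ {δ | ∀ j ∈ J \ I, y δ ∈ X (δ j)})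
      · rw [Set.indicator_of_mem hb, Set.indicator_of_mem (hiff.1 hb)]; rfl
      · rw [Set.indicator_of_notMem hb, Set.indicator_of_notMem (mt hiff.2 hb)]
    have hms : MeasurableSet {d | y δ₀ ∈ X d} := measurable_prodMk_right hX
    rw [hset, lintegral_indicator_one, Measure.pi_pi]
    · have : ∀ j : {j // j ∉ I}, P (if (j : Fin N) ∈ J then {d | y δ₀ ∈ X d} else Set.univ)
          = if (j : Fin N) ∈ J then P {d | y δ₀ ∈ X d} else 1 := by
        intro j
        split_ifs <;> simp
      simp only [this]
      rw [Finset.prod_ite, Finset.prod_const_one, mul_one, Finset.prod_const]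
      congr 1
      refine Finset.card_bij (fun j _ => (j : Fin N)) ?_ ?_ ?_
      · intro j hj
        simp only [Finset.mem_filter, Finset.mem_univ, true_and] at hj
        exact Finset.mem_sdiff.2 ⟨hj, j.2⟩
      · intro j _ k _ hjk
        exact Subtype.ext hjk
      · intro j hj
        obtain ⟨h1, h2⟩ := Finset.mem_sdiff.1 hj
        exact ⟨⟨j, h2⟩, by simpa using h1, rfl⟩
    · refine MeasurableSet.univ_pi fun j => ?_
      split_ifs
      · exact hms
      · exact MeasurableSet.univ
  · have hL : ∀ b, (G ∩ {δ | ∀ j ∈ J \ I, y δ ∈ X (δ j)}).indicator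
        (1 : (Fin N → Δ) → ENNReal) (e (a, b)) = 0 :=
      fun b => Set.indicator_of_notMem (fun hb => h₀ ((hGb b).1 hb.1)) _
    have hR : ∀ b, G.indicator (fun δ => P {d | y δ ∈ X d} ^ (J \ I).card) (e (a, b)) = 0 :=
      fun b => Set.indicator_of_notMem (fun hb => h₀ ((hGb b).1 hb)) _
    simp only [Function.comp_def] at hR ⊢
    simp only [hL, hR]

end Probability
-- Measurability of subproblem solutions and events.
section Bound

variable {n N : ℕ} {Δ : Type*} [MeasurableSpace Δ] {P : Measure Δ}
  {F : EuclideanSpace ℝ (Fin n) → EuclideanSpace ℝ (Fin n)}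
  {X : Δ → Set (EuclideanSpace ℝ (Fin n))}
  {xstar : (m : ℕ) → (Fin m → Δ) → EuclideanSpace ℝ (Fin n)}

/-- For nonempty `I` this is `xstar` applied to the samples in `I`, listed in increasing order; for
empty `I` it does not depend on the samples. -/
theorem IsUniqueSolution.measurable_chosenSolution (h : IsUniqueSolution F X xstar)
    (hmeas : ∀ m : ℕ, 1 ≤ m → Measurable (xstar m)) (I : Finset (Fin N)) :
    Measurable fun δ : Fin N → Δ => chosenSolution F (feasibleSet X δ I) := by
  rcases I.eq_empty_or_nonempty with rfl | hI
  · simp only [Finset.coe_empty, feasibleSet_empty]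
    exact measurable_const
  · simp only [chosenSolution_eq (h.solutionSet_coe_finset hI)]
    exact (hmeas _ hI.card_pos).comp (measurable_pi_lambda _ fun j => measurable_pi_apply _)

theorem IsUniqueSolution.measurableSet_exists_eq_singleton (h : IsUniqueSolution F X xstar)
    (I : Finset (Fin N)) :
    MeasurableSet {δ : Fin N → Δ | ∃ x, solutionSet F (feasibleSet X δ I) = {x}} := by
  rcases I.eq_empty_or_nonempty with rfl | hI
  · simp only [Finset.coe_empty, feasibleSet_empty]
    exact MeasurableSet.const _
  · simp only [h.exists_eq_singleton _ (I := (I : Set (Fin N))) (by simpa using hI)]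
    exact MeasurableSet.const _

theorem IsUniqueSolution.measurableSet_isIrreducible (h : IsUniqueSolution F X xstar)
    (hmeas : ∀ m : ℕ, 1 ≤ m → Measurable (xstar m)) (I : Finset (Fin N)) :
    MeasurableSet {δ : Fin N → Δ | IsIrreducible F X I δ} := by
  classical
  -- Equality of solution sets is replaced by equality of chosen points. The existence clause for
  -- `I.erase i` excludes accidental agreement with a default or arbitrary choice when that set is
  -- empty.
  have heq : {δ : Fin N → Δ | IsIrreducible F X I δ}
      = {δ | ∃ x, solutionSet F (feasibleSet X δ I) = {x}} ∩ ⋂ i ∈ I,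
        ({δ | ∃ x, solutionSet F (feasibleSet X δ ↑(I.erase i)) = {x}} ∩
          {δ | chosenSolution F (feasibleSet X δ ↑(I.erase i))
            = chosenSolution F (feasibleSet X δ I)})ᶜ := by
    ext δ
    simp only [IsIrreducible, Set.mem_ofPred_eq, Set.mem_inter_iff, Set.mem_iInter,
      Set.mem_compl_iff, Finset.mem_coe, ← Finset.coe_erase]
    refine and_congr_right ?_
    rintro ⟨x, hx⟩
    refine forall₂_congr fun i _ => not_congr ⟨fun he => ?_, ?_⟩
    · rw [he]
      exact ⟨⟨x, hx⟩, by rw [chosenSolution_eq hx, chosenSolution_eq (he.trans hx)]⟩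
    · rintro ⟨⟨y, hy⟩, hyx⟩
      rw [chosenSolution_eq hx, chosenSolution_eq hy] at hyx
      rw [hx, hy, hyx]
  rw [heq]
  refine (h.measurableSet_exists_eq_singleton I).inter
    (Finset.measurableSet_biInter _ fun i _ => MeasurableSet.compl ?_)
  exact (h.measurableSet_exists_eq_singleton _).inter
    (measurableSet_eq_fun (h.measurable_chosenSolution hmeas _)
      (h.measurable_chosenSolution hmeas I))

/-- The samples for which the constraints in `I` are irreducible and the solution they determine
has risk less than one. -/
def irreducibleEvent (P : Measure Δ) (F : EuclideanSpace ℝ (Fin n) → EuclideanSpace ℝ (Fin n))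
    (X : Δ → Set (EuclideanSpace ℝ (Fin n))) (I : Finset (Fin N)) : Set (Fin N → Δ) :=
  {δ | IsIrreducible F X I δ ∧ 0 < P {d | chosenSolution F (feasibleSet X δ I) ∈ X d}}

/-- The part of `irreducibleEvent` on which the solution determined by the constraints in `I`
satisfies those in `J` too. -/
def decisiveEvent (P : Measure Δ) (F : EuclideanSpace ℝ (Fin n) → EuclideanSpace ℝ (Fin n))
    (X : Δ → Set (EuclideanSpace ℝ (Fin n))) (I J : Finset (Fin N)) : Set (Fin N → Δ) :=
  irreducibleEvent P F X I ∩ {δ | ∀ j ∈ J \ I, chosenSolution F (feasibleSet X δ I) ∈ X (δ j)}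

theorem IsUniqueSolution.measurableSet_irreducibleEvent [IsProbabilityMeasure P]
    (h : IsUniqueSolution F X xstar)
    (hX : MeasurableSet {p : Δ × EuclideanSpace ℝ (Fin n) | p.2 ∈ X p.1})
    (hmeas : ∀ m : ℕ, 1 ≤ m → Measurable (xstar m)) (I : Finset (Fin N)) :
    MeasurableSet (irreducibleEvent P F X I) :=
  (h.measurableSet_isIrreducible hmeas I).inter (measurableSet_lt measurable_const
    ((measurable_measure_constraint hX).comp (h.measurable_chosenSolution hmeas I)))

theorem IsUniqueSolution.measurableSet_decisiveEvent [IsProbabilityMeasure P]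
    (h : IsUniqueSolution F X xstar)
    (hX : MeasurableSet {p : Δ × EuclideanSpace ℝ (Fin n) | p.2 ∈ X p.1})
    (hmeas : ∀ m : ℕ, 1 ≤ m → Measurable (xstar m)) (I J : Finset (Fin N)) :
    MeasurableSet (decisiveEvent P F X I J) := by
  refine (h.measurableSet_irreducibleEvent hX hmeas I).inter ?_
  simp only [Set.ofPred_forall]
  exact MeasurableSet.iInter fun j => MeasurableSet.iInter fun _ =>
    ((measurable_pi_apply j).prodMk (h.measurable_chosenSolution hmeas I)) hX

theorem mem_irreducibleEvent_congr {I : Finset (Fin N)} {δ δ' : Fin N → Δ}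
    (h : ∀ i ∈ I, δ i = δ' i) :
    δ ∈ irreducibleEvent P F X I ↔ δ' ∈ irreducibleEvent P F X I := by
  unfold irreducibleEvent
  simp only [Set.mem_ofPred_eq]
  rw [isIrreducible_congr (I := (I : Set (Fin N))) h,
    feasibleSet_congr (X := X) (I := (I : Set (Fin N))) h]

theorem mem_decisiveEvent_congr {I J : Finset (Fin N)} (hIJ : I ⊆ J) {δ δ' : Fin N → Δ}
    (h : ∀ i ∈ J, δ i = δ' i) :
    δ ∈ decisiveEvent P F X I J ↔ δ' ∈ decisiveEvent P F X I J := by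
  have hI : ∀ i ∈ I, δ i = δ' i := fun i hi => h i (hIJ hi)
  unfold decisiveEvent
  simp only [Set.mem_inter_iff, mem_irreducibleEvent_congr hI, Set.mem_ofPred_eq]
  rw [feasibleSet_congr (X := X) (I := (I : Set (Fin N))) hI]
  refine and_congr_right fun _ => forall₂_congr fun j hj => ?_
  rw [h j (Finset.mem_sdiff.1 hj).1]

/-- On the decisive event, `I` and `J` determine the same solution. -/
theorem IsUniqueSolution.solutionSet_of_mem_decisiveEvent (h : IsUniqueSolution F X xstar)
    {I J : Finset (Fin N)} (hIJ : I ⊆ J) {δ : Fin N → Δ} (hδ : δ ∈ decisiveEvent P F X I J) :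
    solutionSet F (feasibleSet X δ I) = {chosenSolution F (feasibleSet X δ J)} ∧
      solutionSet F (feasibleSet X δ J) = {chosenSolution F (feasibleSet X δ J)} := by
  obtain ⟨⟨⟨⟨x, hx⟩, -⟩, -⟩, hJ⟩ := hδ
  simp only [Set.mem_ofPred_eq, chosenSolution_eq hx] at hJ
  have hxI : x ∈ feasibleSet X δ I :=
    (show x ∈ solutionSet F (feasibleSet X δ I) by rw [hx]; rfl).1
  have hxJ : x ∈ feasibleSet X δ J := by
    refine mem_feasibleSet.2 fun j hj => ?_
    by_cases hjI : j ∈ I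
    · exact mem_feasibleSet.1 hxI j hjI
    · exact hJ j (Finset.mem_sdiff.2 ⟨hj, hjI⟩)
  have hsJ := h.solutionSet_eq_of_subset (Finset.coe_subset.2 hIJ) hx hxJ
  rw [chosenSolution_eq hsJ]
  exact ⟨hx, hsJ⟩

/-! ### Almost sure disjointness of the decisive events. -/

/-- Non-degeneracy makes the decisive events of the subsets of `J` almost surely disjoint. -/
theorem IsUniqueSolution.aedisjoint_decisiveEvent [IsProbabilityMeasure P]
    (h : IsUniqueSolution F X xstar)
    (hX : MeasurableSet {p : Δ × EuclideanSpace ℝ (Fin n) | p.2 ∈ X p.1})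
    (hmeas : ∀ m : ℕ, 1 ≤ m → Measurable (xstar m)) (hnd : NonDegenerate P F X N)
    {I I' J : Finset (Fin N)} (hI : I ⊆ J) (hI' : I' ⊆ J) (hne : I ≠ I') :
    AEDisjoint (Measure.pi fun _ : Fin N => P) (decisiveEvent P F X I J)
      (decisiveEvent P F X I' J) := by
  set G := decisiveEvent P F X I J ∩ decisiveEvent P F X I' J with hGdef
  have hG : MeasurableSet G := (h.measurableSet_decisiveEvent hX hmeas I J).inter
    (h.measurableSet_decisiveEvent hX hmeas I' J)
  have hy := h.measurable_chosenSolution (N := N) hmeas J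
  have hF := measure_pi_inter_constraints (P := P) hX J Finset.univ hG hy
    (fun δ δ' hd => and_congr (mem_decisiveEvent_congr hI hd) (mem_decisiveEvent_congr hI' hd))
    (fun δ δ' hd => by rw [feasibleSet_congr (X := X) (I := (J : Set (Fin N))) hd])
  have hnull : (Measure.pi fun _ : Fin N => P) (G ∩ {δ | ∀ j ∈ Finset.univ \ J,
      chosenSolution F (feasibleSet X δ J) ∈ X (δ j)}) = 0 := by
    -- If the common solution also satisfies the constraints outside `J`, non-degeneracy would
    -- identify both `I` and `I'` with the support set.
    refine measure_mono_null ?_ (ae_iff.1 hnd)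
    rintro δ ⟨⟨hδI, hδI'⟩, hδ⟩ hs
    obtain ⟨h1, h2⟩ := h.solutionSet_of_mem_decisiveEvent hI hδI
    obtain ⟨h1', -⟩ := h.solutionSet_of_mem_decisiveEvent hI' hδI'
    set x := chosenSolution F (feasibleSet X δ J)
    have hxJ : x ∈ feasibleSet X δ J :=
      (show x ∈ solutionSet F (feasibleSet X δ J) by rw [h2]; rfl).1
    have hxu : x ∈ feasibleSet X δ Set.univ := by
      refine mem_feasibleSet.2 fun j _ => ?_
      by_cases hjJ : j ∈ J
      · exact mem_feasibleSet.1 hxJ j hjJ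
      · exact hδ j (Finset.mem_sdiff.2 ⟨Finset.mem_univ j, hjJ⟩)
    exact hne (Finset.coe_injective
      ((h.eq_supportConstraints hs hδI.1.1 h1 hxu).trans
        (h.eq_supportConstraints hs hδI'.1.1 h1' hxu).symm))
  rw [hnull] at hF
  -- The null probability is the integral over `G` of a power of the acceptance probability, which
  -- is positive on `G`; hence `G` itself is null.
  have hz := (setLIntegral_eq_zero_iff hG
    (((measurable_measure_constraint hX).comp hy).pow_const _)).1 hF.symm
  refine measure_mono_null ?_ (ae_iff.1 hz)
  intro δ hδ hzero
  obtain ⟨h1, -⟩ := h.solutionSet_of_mem_decisiveEvent hI hδ.1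
  have hpos := hδ.1.1.2
  rw [chosenSolution_eq h1] at hpos
  exact pow_ne_zero _ hpos.ne' (hzero hδ)

theorem IsUniqueSolution.sum_measure_decisiveEvent_le [IsProbabilityMeasure P]
    (h : IsUniqueSolution F X xstar)
    (hX : MeasurableSet {p : Δ × EuclideanSpace ℝ (Fin n) | p.2 ∈ X p.1})
    (hmeas : ∀ m : ℕ, 1 ≤ m → Measurable (xstar m)) (hnd : NonDegenerate P F X N)
    (J : Finset (Fin N)) :
    ∑ I with I ⊆ J, (Measure.pi fun _ : Fin N => P) (decisiveEvent P F X I J) ≤ 1 := by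
  rw [← measure_biUnion_finset₀]
  · exact prob_le_one
  · intro I hI I' hI' hne
    exact h.aedisjoint_decisiveEvent hX hmeas hnd (by simpa using hI) (by simpa using hI') hne
  · exact fun I _ => (h.measurableSet_decisiveEvent hX hmeas I J).nullMeasurableSet

theorem IsUniqueSolution.measure_decisiveEvent [IsProbabilityMeasure P]
    (h : IsUniqueSolution F X xstar)
    (hX : MeasurableSet {p : Δ × EuclideanSpace ℝ (Fin n) | p.2 ∈ X p.1})
    (hmeas : ∀ m : ℕ, 1 ≤ m → Measurable (xstar m)) (I J : Finset (Fin N)) :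
    (Measure.pi fun _ : Fin N => P) (decisiveEvent P F X I J)
      = ∫⁻ δ in irreducibleEvent P F X I,
          P {d | chosenSolution F (feasibleSet X δ I) ∈ X d} ^ (J \ I).card
            ∂(Measure.pi fun _ : Fin N => P) :=
  measure_pi_inter_constraints hX I J (h.measurableSet_irreducibleEvent hX hmeas I)
    (h.measurable_chosenSolution hmeas I) (fun _ _ hd => mem_irreducibleEvent_congr hd)
    (fun δ δ' hd => by rw [feasibleSet_congr (X := X) (I := (I : Set (Fin N))) hd])

/-! ### The failure probability. -/

/-- The samples for which the irreducible constraints in `I` determine a solution that satisfies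
all the constraints but has a risk above the level attached to `#I`. -/
def failureEvent (P : Measure Δ) (F : EuclideanSpace ℝ (Fin n) → EuclideanSpace ℝ (Fin n))
    (X : Δ → Set (EuclideanSpace ℝ (Fin n))) (t : ℕ → ℝ) (I : Finset (Fin N)) :
    Set (Fin N → Δ) :=
  (irreducibleEvent P F X I ∩
    {δ | P.real {d | chosenSolution F (feasibleSet X δ I) ∈ X d} < t I.card}) ∩
    {δ | ∀ j ∈ Finset.univ \ I, chosenSolution F (feasibleSet X δ I) ∈ X (δ j)}

theorem IsUniqueSolution.measure_failureEvent_le [IsProbabilityMeasure P]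
    (h : IsUniqueSolution F X xstar)
    (hX : MeasurableSet {p : Δ × EuclideanSpace ℝ (Fin n) | p.2 ∈ X p.1})
    (hmeas : ∀ m : ℕ, 1 ≤ m → Measurable (xstar m)) {β : ℝ} (hβ : 0 < β) {t : ℕ → ℝ}
    (ht : IsThreshold β N t) (I : Finset (Fin N)) :
    (Measure.pi fun _ : Fin N => P) (failureEvent P F X t I) ≤
      ∑ J with I ⊆ J, ENNReal.ofReal (β / ((N : ℝ) + 1) / (N.choose J.card : ℝ)) *
        (Measure.pi fun _ : Fin N => P) (decisiveEvent P F X I J) := by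
  have hy := h.measurable_chosenSolution (N := N) hmeas I
  have hp : Measurable fun δ : Fin N → Δ =>
      P {d | chosenSolution F (feasibleSet X δ I) ∈ X d} :=
    (measurable_measure_constraint hX).comp hy
  have hG : MeasurableSet (irreducibleEvent P F X I ∩
      {δ : Fin N → Δ | P.real {d | chosenSolution F (feasibleSet X δ I) ∈ X d} < t I.card}) :=
    (h.measurableSet_irreducibleEvent hX hmeas I).inter
      (measurableSet_lt hp.ennreal_toReal measurable_const)
  have hF := measure_pi_inter_constraints (P := P) hX I Finset.univ hG hy
    (fun δ δ' hd => and_congr (mem_irreducibleEvent_congr hd) (by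
      simp only [Set.mem_ofPred_eq]
      rw [feasibleSet_congr (X := X) (I := (I : Set (Fin N))) hd]))
    (fun δ δ' hd => by rw [feasibleSet_congr (X := X) (I := (I : Set (Fin N))) hd])
  have hcard : (Finset.univ \ I).card = N - I.card := by
    rw [← Finset.compl_eq_univ_sdiff, Finset.card_compl, Fintype.card_fin]
  simp only [h.measure_decisiveEvent hX hmeas]
  simp only [← lintegral_const_mul _ (hp.pow_const _)]
  rw [← lintegral_finsetSum _ fun J _ => (hp.pow_const _).const_mul _]
  -- The pointwise comparison needs `q < t I.card`; afterwards this restriction is dropped, which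
  -- only enlarges the integral.
  refine hF.trans_le ((setLIntegral_mono' hG fun δ hδ => ?_).trans
    (lintegral_mono_set Set.inter_subset_left))
  rw [hcard]
  have hq : P {d | chosenSolution F (feasibleSet X δ I) ∈ X d}
      = ENNReal.ofReal (P.real {d | chosenSolution F (feasibleSet X δ I) ∈ X d}) :=
    (ofReal_measureReal).symm
  have hqpos : 0 < P.real {d | chosenSolution F (feasibleSet X δ I) ∈ X d} :=
    ENNReal.toReal_pos hδ.1.2.ne' (measure_ne_top _ _)
  have hqt : P.real {d | chosenSolution F (feasibleSet X δ I) ∈ X d} < t I.card := hδ.2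
  have hIN : I.card < N := by
    by_contra! hle
    rw [ht.2 _ hle] at hqt
    exact lt_asymm hqpos hqt
  rw [hq]
  generalize P.real {d | chosenSolution F (feasibleSet X δ I) ∈ X d} = q at hqpos hqt
  have hw : ∀ J : Finset (Fin N), 0 ≤ β / ((N : ℝ) + 1) / (N.choose J.card : ℝ) :=
    fun J => by positivity
  simp only [← ENNReal.ofReal_pow hqpos.le, ← ENNReal.ofReal_mul (hw _)]
  rw [← ENNReal.ofReal_sum_of_nonneg fun J _ => mul_nonneg (hw J) (pow_pos hqpos _).le]
  exact ENNReal.ofReal_le_ofReal (ht.pow_le_sum_supersets hβ I hIN hqpos hqt)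

/-- Exchanging the sums isolates, for each `J`, the total probability of its decisive events, which
is at most one; only the weights remain. -/
theorem IsUniqueSolution.sum_measure_failureEvent_le [IsProbabilityMeasure P]
    (h : IsUniqueSolution F X xstar)
    (hX : MeasurableSet {p : Δ × EuclideanSpace ℝ (Fin n) | p.2 ∈ X p.1})
    (hmeas : ∀ m : ℕ, 1 ≤ m → Measurable (xstar m)) (hnd : NonDegenerate P F X N)
    {β : ℝ} (hβ : 0 < β) {t : ℕ → ℝ} (ht : IsThreshold β N t) :
    ∑ I : Finset (Fin N), (Measure.pi fun _ : Fin N => P) (failureEvent P F X t I)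
      ≤ ENNReal.ofReal β := by
  calc ∑ I : Finset (Fin N), (Measure.pi fun _ : Fin N => P) (failureEvent P F X t I)
      ≤ ∑ I : Finset (Fin N), ∑ J with I ⊆ J,
          ENNReal.ofReal (β / ((N : ℝ) + 1) / (N.choose J.card : ℝ)) *
            (Measure.pi fun _ : Fin N => P) (decisiveEvent P F X I J) :=
        Finset.sum_le_sum fun I _ => h.measure_failureEvent_le hX hmeas hβ ht I
    _ = ∑ J : Finset (Fin N), ∑ I with I ⊆ J,
          ENNReal.ofReal (β / ((N : ℝ) + 1) / (N.choose J.card : ℝ)) *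
            (Measure.pi fun _ : Fin N => P) (decisiveEvent P F X I J) :=
        Finset.sum_comm' fun I J => by simp
    _ ≤ ∑ J : Finset (Fin N), ENNReal.ofReal (β / ((N : ℝ) + 1) / (N.choose J.card : ℝ)) := by
        refine Finset.sum_le_sum fun J _ => ?_
        rw [← Finset.mul_sum]
        exact mul_le_of_le_one_right' (h.sum_measure_decisiveEvent_le hX hmeas hnd J)
    _ = ENNReal.ofReal β := by
        rw [← ENNReal.ofReal_sum_of_nonneg fun J _ => by positivity, sum_subset_weights]

/-- Satisfying the sampled constraints, the solution has positive acceptance probability almost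
surely if it is determined by fewer than `N` constraints. -/
theorem IsUniqueSolution.ae_measure_constraint_pos [IsProbabilityMeasure P]
    (h : IsUniqueSolution F X xstar)
    (hX : MeasurableSet {p : Δ × EuclideanSpace ℝ (Fin n) | p.2 ∈ X p.1})
    (hmeas : ∀ m : ℕ, 1 ≤ m → Measurable (xstar m)) {I : Finset (Fin N)} (hI : I.card < N) :
    ∀ᵐ δ ∂(Measure.pi fun _ : Fin N => P),
      (∀ j ∈ Finset.univ \ I, chosenSolution F (feasibleSet X δ I) ∈ X (δ j)) →
        0 < P {d | chosenSolution F (feasibleSet X δ I) ∈ X d} := by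
  have hy := h.measurable_chosenSolution (N := N) hmeas I
  have hp : Measurable fun δ : Fin N → Δ =>
      P {d | chosenSolution F (feasibleSet X δ I) ∈ X d} :=
    (measurable_measure_constraint hX).comp hy
  have hG : MeasurableSet
      {δ : Fin N → Δ | P {d | chosenSolution F (feasibleSet X δ I) ∈ X d} = 0} :=
    measurableSet_eq_fun hp measurable_const
  have hF := measure_pi_inter_constraints (P := P) hX I Finset.univ hG hy
    (fun δ δ' hd => by
      simp only [Set.mem_ofPred_eq]
      rw [feasibleSet_congr (X := X) (I := (I : Set (Fin N))) hd])
    (fun δ δ' hd => by rw [feasibleSet_congr (X := X) (I := (I : Set (Fin N))) hd])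
  have hcard : (Finset.univ \ I).card ≠ 0 := by
    rw [← Finset.compl_eq_univ_sdiff, Finset.card_compl, Fintype.card_fin]
    omega
  rw [(setLIntegral_eq_zero_iff hG (hp.pow_const _)).2
    (Filter.Eventually.of_forall fun δ hδ => by
      rw [Set.mem_ofPred_eq] at hδ
      rw [hδ, zero_pow hcard])] at hF
  refine measure_mono_null (fun δ hδ => ?_) hF
  simp only [Set.mem_compl_iff, Set.mem_ofPred_eq, Classical.not_imp, not_lt,
    nonpos_iff_eq_zero] at hδ
  exact ⟨hδ.2, hδ.1⟩

theorem IsUniqueSolution.measure_risk_gt_le [IsProbabilityMeasure P]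
    (h : IsUniqueSolution F X xstar)
    (hX : MeasurableSet {p : Δ × EuclideanSpace ℝ (Fin n) | p.2 ∈ X p.1})
    (hmeas : ∀ m : ℕ, 1 ≤ m → Measurable (xstar m)) (hN : 1 ≤ N) (hnd : NonDegenerate P F X N)
    {β : ℝ} (hβ : 0 < β) {t : ℕ → ℝ} (ht : IsThreshold β N t) :
    (Measure.pi fun _ : Fin N => P)
      {δ | ¬ risk P X (xstar N δ) ≤ 1 - t (numSupport F X δ)} ≤ ENNReal.ofReal β := by
  classical
  have hpos : ∀ᵐ δ ∂(Measure.pi fun _ : Fin N => P), ∀ I : Finset (Fin N), I.card < N →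
      (∀ j ∈ Finset.univ \ I, chosenSolution F (feasibleSet X δ I) ∈ X (δ j)) →
        0 < P {d | chosenSolution F (feasibleSet X δ I) ∈ X d} :=
    ae_all_iff.2 fun I => Filter.eventually_imp_distrib_left.2 fun hI =>
      h.ae_measure_constraint_pos hX hmeas hI
  -- Up to a null set, a sample violating the bound lies in the failure event of its own support
  -- set.
  refine le_trans (measure_mono_ae ?_) ((measure_biUnion_finset_le Finset.univ
    (failureEvent P F X t)).trans (h.sum_measure_failureEvent_le hX hmeas hnd hβ ht))
  filter_upwards [hnd, hpos] with δ hs hp hδ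
  have hx := h N hN δ
  set x := xstar N δ
  have hxu : x ∈ feasibleSet X δ Set.univ :=
    (show x ∈ solutionSet F (feasibleSet X δ Set.univ) by rw [hx]; rfl).1
  set I := (supportConstraints F X δ).toFinite.toFinset with hIdef
  have hIs : (I : Set (Fin N)) = supportConstraints F X δ := Set.Finite.coe_toFinset _
  have hIcard : I.card = numSupport F X δ := (Set.ncard_eq_toFinset_card _ _).symm
  have hirr := h.isIrreducible_supportConstraints hx hs
  have hxI : chosenSolution F (feasibleSet X δ I) = x := by
    rw [hIs]
    exact chosenSolution_eq (hs.trans hx)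
  have hall : ∀ j ∈ Finset.univ \ I, chosenSolution F (feasibleSet X δ I) ∈ X (δ j) :=
    fun j _ => by rw [hxI]; exact mem_feasibleSet.1 hxu j trivial
  have hδ' : ¬ risk P X x ≤ 1 - t (numSupport F X δ) := hδ
  rw [risk_eq hX, ← hIcard] at hδ'
  have hlt : P.real {d | x ∈ X d} < t I.card := by linarith
  -- If all constraints are of support, the threshold is `0` and the risk bound `1` cannot be
  -- violated.
  have hIN : I.card < N := by
    by_contra! hle
    rw [ht.2 _ hle] at hlt
    exact hlt.not_ge measureReal_nonneg
  refine Set.mem_iUnion₂.2 ⟨I, Finset.mem_univ I, ⟨⟨?_, hp I hIN hall⟩, ?_⟩, hall⟩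
  · rwa [hIs]
  · simpa only [Set.mem_ofPred_eq, hxI] using hlt

/-- An event whose complement has outer measure at most `β` has probability at least `1 - β`. -/
theorem one_sub_le_measureReal {Ω : Type*} [MeasurableSpace Ω] {μ : Measure Ω}
    [IsProbabilityMeasure μ] {β : ℝ} (hβ : 0 ≤ β) {S : Set Ω} (hS : μ Sᶜ ≤ ENNReal.ofReal β) :
    1 - β ≤ μ.real S := by
  have h1 : (1 : ℝ) ≤ μ.real S + μ.real Sᶜ := by
    have := measureReal_union_le (μ := μ) S Sᶜ
    rwa [Set.union_compl_self, probReal_univ] at this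
  have h2 : μ.real Sᶜ ≤ β := ENNReal.toReal_le_of_le_ofReal hβ hS
  linarith

end Bound

end ScenarioVI

theorem theorem1 {n : ℕ} {Δ : Type*} [MeasurableSpace Δ] (P : Measure Δ) [IsProbabilityMeasure P]
    (F : EuclideanSpace ℝ (Fin n) → EuclideanSpace ℝ (Fin n))
    (X : Δ → Set (EuclideanSpace ℝ (Fin n)))
    (hX : MeasurableSet {p : Δ × EuclideanSpace ℝ (Fin n) | p.2 ∈ X p.1})
    (xstar : (m : ℕ) → (Fin m → Δ) → EuclideanSpace ℝ (Fin n))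
    (hmeas : ∀ m : ℕ, 1 ≤ m → Measurable (xstar m))
    (hsol : ScenarioVI.IsUniqueSolution F X xstar)
    (N : ℕ) (hN : 1 ≤ N)
    (hnd : ScenarioVI.NonDegenerate P F X N)
    (β : ℝ) (hβ : β ∈ Set.Ioo (0 : ℝ) 1) :
    (∃! t : ℕ → ℝ, ScenarioVI.IsThreshold β N t) ∧
    ∀ t : ℕ → ℝ, ScenarioVI.IsThreshold β N t →
      (1 - β ≤ (Measure.pi fun _ : Fin N => P).real
        {δ | ScenarioVI.risk P X (xstar N δ) ≤ 1 - t (ScenarioVI.numSupport F X δ)}) ∧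
      (∀ δ : Fin N → Δ, (∀ i, Convex ℝ (X (δ i))) → ScenarioVI.numSupport F X δ ≤ n) ∧
      ((∀ᵐ δ ∂(Measure.pi fun _ : Fin N => P), ∀ i, Convex ℝ (X (δ i))) →
        1 - β ≤ (Measure.pi fun _ : Fin N => P).real
          {δ | ScenarioVI.risk P X (xstar N δ) ≤ 1 - t n}) := by
  refine ⟨ScenarioVI.existsUnique_isThreshold hβ N, fun t ht => ?_⟩
  have hbad := hsol.measure_risk_gt_le hX hmeas hN hnd hβ.1 ht
  refine ⟨ScenarioVI.one_sub_le_measureReal hβ.1.le hbad,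
    fun δ hδ => hsol.numSupport_le hN δ hδ, fun hconv => ?_⟩
  refine ScenarioVI.one_sub_le_measureReal hβ.1.le ((measure_mono_ae ?_).trans hbad)
  filter_upwards [hconv] with δ hδ hrisk hle
  have hmono : t n ≤ t (ScenarioVI.numSupport F X δ) :=
    ht.antitone hβ.1 (hsol.numSupport_le hN δ hδ)
  exact hrisk (le_trans hle (by linarith))
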